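/- Let $r>0$, $\mu>r$, $\sigma>0$, $c>0$, $\lambda>0$, $\varepsilon\ge 0$ be real numbers, put $w_s:=c/r$ and let $b<w_s$. For $w,z,p,A\in\mathbb R$ let $$F(w,z,p,A):=\lambda z-\inf_{\pi\in\mathbb R}\Big\{\tfrac12\sigma^2(\varepsilon p^2+A)\pi^2+(\mu-r)p\,\pi+(rw-c)p\Big\}\in(-\infty,+\infty].$$ A function $u:[b,w_s]\to\mathbb R$ is called a viscosity subsolution (resp. supersolution) of $F=0$ if $F(w_0,u(w_0),\varphi'(w_0),\varphi''(w_0))\le 0$ (resp. $\ge 0$) whenever $\varphi\in C^2(b,w_s)$, $w_0\in(b,w_s)$, and $u-\varphi$ attains its maximum (resp. minimum) over $(b,w_s)$ at $w_0$. A bounded function $u:[b,w_s]\to\mathbb R$, not assumed continuous, is called a viscosity solution of $F=0$ if its upper semicontinuous envelope $u^*$ is a viscosity subsolution and its lower semicontinuous envelope $u_*$ is a viscosity supersolution. 1. (Comparison.) Let $u,v:[b,w_s]\to\mathbb R$ be bounded, let $u$ be an upper semicontinuous viscosity subsolution and $v$ a lower semicontinuous viscosity supersolution of $F=0$, and suppose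 that either $v\ge 0$ on $(b,w_s)$ or $u>0$ on $(b,w_s)$. If $u(b)\le v(b)$ and $u(w_s)\le v(w_s)$, then $u\le v$ on $[b,w_s]$. 2. (Uniqueness.) There is at most one function $u:[b,w_s]\to[0,\infty)$ that is bounded, is continuous at $b$ and at $w_s$, satisfies $u(b)=1$ and $u(w_s)=0$, and is a viscosity solution of $F=0$. -/

import Mathlib

open Set Filter Topology

noncomputable section

/-- The expression inside the braces of the HJB equation, for a portfolio amount `π`:
`(1/2) σ² (ε p² + A) π² + (μ - r) p π + (r w - c) p`, where `p`, `A` stand for `u'`, `u''`. -/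
def hjbIntegrand (r μ σ c ε w p A π : ℝ) : ℝ :=
  1 / 2 * σ ^ 2 * (ε * p ^ 2 + A) * π ^ 2 + (μ - r) * p * π + (r * w - c) * p

/-- The operator `F(w, z, p, A) = lam z - inf_{π ∈ ℝ} {...}`. The infimum is taken in the extended
reals, where it is either finite or `-∞`; hence `F` is either finite or `+∞`. -/
def hjbF (r μ σ c lam ε w z p A : ℝ) : EReal :=
  ((lam * z : ℝ) : EReal) - ⨅ π : ℝ, ((hjbIntegrand r μ σ c ε w p A π : ℝ) : EReal)

/-- The test-function property of a viscosity subsolution of `F(w, u, u', u'') = 0` in the open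
interval `(a, d)`: `F(w₀, u(w₀), φ'(w₀), φ''(w₀)) ≤ 0` whenever `φ` is `C²` on `(a, d)` and `u - φ`
attains its maximum over `(a, d)` at `w₀`. Semicontinuity of `u` is a separate requirement. -/
def IsViscositySubsolution (F : ℝ → ℝ → ℝ → ℝ → EReal) (a d : ℝ) (u : ℝ → ℝ) : Prop :=
  ∀ φ : ℝ → ℝ, ContDiffOn ℝ 2 φ (Ioo a d) → ∀ w₀ ∈ Ioo a d,
    IsMaxOn (fun w => u w - φ w) (Ioo a d) w₀ →
      F w₀ (u w₀) (deriv φ w₀) (deriv (deriv φ) w₀) ≤ 0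

/-- The test-function property of a viscosity supersolution of `F(w, v, v', v'') = 0` in the open
interval `(a, d)`: `F(w₀, v(w₀), φ'(w₀), φ''(w₀)) ≥ 0` whenever `φ` is `C²` on `(a, d)` and `v - φ`
attains its minimum over `(a, d)` at `w₀`. Semicontinuity of `v` is a separate requirement. -/
def IsViscositySupersolution (F : ℝ → ℝ → ℝ → ℝ → EReal) (a d : ℝ) (v : ℝ → ℝ) : Prop :=
  ∀ φ : ℝ → ℝ, ContDiffOn ℝ 2 φ (Ioo a d) → ∀ w₀ ∈ Ioo a d,
    IsMinOn (fun w => v w - φ w) (Ioo a d) w₀ →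
      0 ≤ F w₀ (v w₀) (deriv φ w₀) (deriv (deriv φ) w₀)

/-- `u` is bounded on `s`. -/
def BoundedOn (s : Set ℝ) (u : ℝ → ℝ) : Prop :=
  ∃ M : ℝ, ∀ w ∈ s, |u w| ≤ M

/-- Upper semicontinuous envelope, relative to `s`, of a function that is bounded on `s`:
`u^*(w) = limsup u(x)` as `x → w` in `s`, with `x = w` allowed. -/
def uscEnvelope (s : Set ℝ) (u : ℝ → ℝ) (w : ℝ) : ℝ :=
  limsup u (𝓝[s] w)

/-- Lower semicontinuous envelope, relative to `s`, of a function that is bounded on `s`: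
`u_*(w) = liminf u(x)` as `x → w` in `s`, with `x = w` allowed. -/
def lscEnvelope (s : Set ℝ) (u : ℝ → ℝ) (w : ℝ) : ℝ :=
  liminf u (𝓝[s] w)

/-- A bounded, possibly discontinuous, function `u` on `[a, d]` is a viscosity solution of
`F(w, u, u', u'') = 0` in `(a, d)` if its upper envelope is a viscosity subsolution and its lower
envelope is a viscosity supersolution. For continuous `u` both envelopes are `u` itself. -/
def IsBoundedViscositySolution (F : ℝ → ℝ → ℝ → ℝ → EReal) (a d : ℝ) (u : ℝ → ℝ) : Prop :=
  BoundedOn (Icc a d) u ∧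
    IsViscositySubsolution F a d (uscEnvelope (Icc a d) u) ∧
      IsViscositySupersolution F a d (lscEnvelope (Icc a d) u)

end

/-! For `ε > 0`, the substitution `U = exp (ε * u)` absorbs the term `ε p²` into the second
derivative. In all cases the equation becomes `H(U) = inf_π {s U'' π² + k U' π + ℓ U'}` with `ℓ ≤
0`, where `H z` is `lam * z` or `lam * (z * log z)`.

An upper jet of negative curvature would make the infimum `-∞`, so the subsolution `U` is convex
(`JetSubsolution.convexOn`). Convexity replaces the doubling of variables: at an interior maximum of
`U - V`, every lower jet of `U` is a lower jet of `V`, so it is enough to produce suitable lower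
jets of `U`. At a kink, all slopes strictly between the one-sided derivatives occur with arbitrary
curvature, and large curvature removes the terms in `π`. At a point of differentiability, a
curvature that strictly violates the subsolution inequality occurs in no upper jet nearby, hence
belongs to a lower jet (`JetSubsolution.lowerJet_of_lt`). Either way `H(U) ≤ H(V)` at the maximum
(`JetSubsolution.le_of_isMaxOn_sub`), whereas the sign hypothesis gives `H(V) < H(U)` wherever `V <
U`. Uniqueness is comparison applied to the envelopes of two solutions. -/

/-! ### Jets, convexity and subgradients. -/

/-- `(p, A)` is a second-order jet touching `U` from above at `x`. -/
def UpperJet (U : ℝ → ℝ) (x p A : ℝ) : Prop :=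
  ∀ᶠ y in 𝓝 x, U y ≤ U x + p * (y - x) + A / 2 * (y - x) ^ 2

/-- `(p, A)` is a second-order jet touching `V` from below at `x`. -/
def LowerJet (V : ℝ → ℝ) (x p A : ℝ) : Prop :=
  ∀ᶠ y in 𝓝 x, V x + p * (y - x) + A / 2 * (y - x) ^ 2 ≤ V y

/-- If no upper jet has second-order part `m`, then `U - m / 2 * x ^ 2` is convex. -/
theorem convexOn_of_no_upperJet {U : ℝ → ℝ} {a d m : ℝ}
    (hU : UpperSemicontinuousOn U (Ioo a d))
    (h : ∀ w ∈ Ioo a d, ∀ q, ¬ UpperJet U w q m) :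
    ConvexOn ℝ (Ioo a d) (fun x => U x - m / 2 * x ^ 2) := by
  refine LinearOrder.convexOn_of_lt (convex_Ioo a d) ?_
  intro x hx y hy hxy s t hs ht hst
  have hsub : Icc x y ⊆ Ioo a d := fun z hz => ⟨hx.1.trans_le hz.1, hz.2.trans_lt hy.2⟩
  set W : ℝ → ℝ := fun x => U x - m / 2 * x ^ 2 with hW
  set k : ℝ := (W y - W x) / (y - x) with hk
  have hk' : k * (y - x) = W y - W x := by
    rw [hk]; field_simp [sub_ne_zero.2 hxy.ne']
  -- The excess of `W` over its chord. A positive interior maximum of `g` would be a contact point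
  -- with a parabola of curvature `m` from above.
  set g : ℝ → ℝ := fun z => U z + (-(m / 2 * z ^ 2) - W x - k * (z - x)) with hg
  have hgu : UpperSemicontinuousOn g (Icc x y) :=
    (hU.mono hsub).add (Continuous.continuousOn (by fun_prop)).upperSemicontinuousOn
  obtain ⟨w, hw, hmax⟩ := hgu.exists_isMaxOn (nonempty_Icc.2 hxy.le) isCompact_Icc
  have hgx : g x = 0 := by simp only [hg, hW]; ring
  have hgy : g y = 0 := by
    have : g y = W y - W x - k * (y - x) := by simp only [hg, hW]; ring
    rw [this, hk']; ring
  have hgw : g w ≤ 0 := by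
    by_contra! hpos
    have hwx : w ≠ x := fun e => by rw [e, hgx] at hpos; exact lt_irrefl _ hpos
    have hwy : w ≠ y := fun e => by rw [e, hgy] at hpos; exact lt_irrefl _ hpos
    have hw' : w ∈ Ioo x y := ⟨lt_of_le_of_ne hw.1 hwx.symm, lt_of_le_of_ne hw.2 hwy⟩
    refine h w (hsub hw) (k + m * w) ?_
    filter_upwards [Ioo_mem_nhds hw'.1 hw'.2] with z hz
    have := hmax (Ioo_subset_Icc_self hz)
    simp only [hg, mem_ofPred_eq] at this
    nlinarith
  have hz : s • x + t • y ∈ Icc x y := by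
    exact convex_Icc x y (left_mem_Icc.2 hxy.le) (right_mem_Icc.2 hxy.le) hs.le ht.le hst
  have h1 : g (s • x + t • y) ≤ 0 := (hmax hz).trans hgw
  have h2 : g (s • x + t • y) = W (s • x + t • y) - W x - k * (s • x + t • y - x) := by
    simp only [hg, hW]; ring
  rw [h2] at h1
  simp only [smul_eq_mul] at h1 ⊢
  have e : s = 1 - t := by linarith
  have h3 : k * (s * x + t * y - x) = t * (k * (y - x)) := by rw [e]; ring
  rw [h3, hk'] at h1
  have : W (s * x + t * y) ≤ s * W x + t * W y := by rw [e] at h1 ⊢; linarith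
  exact this

/-- `q` is a subgradient of `U` at `w` relative to `(a, d)`. -/
def IsSubgradientOn (U : ℝ → ℝ) (a d w q : ℝ) : Prop :=
  ∀ z ∈ Ioo a d, U w + q * (z - w) ≤ U z

/-- The point `w` lies between `z` and `w - t * (z - w)`. Convexity, with the jet bound at the
latter point, gives the tangent inequality at `z` up to an error of order `t`. -/
theorem ConvexOn.isSubgradientOn_of_upperJet {U : ℝ → ℝ} {a d w q A : ℝ}
    (hU : ConvexOn ℝ (Ioo a d) U) (hw : w ∈ Ioo a d) (hj : UpperJet U w q A) :
    IsSubgradientOn U a d w q := by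
  intro z hz
  have hlim : Tendsto (fun t : ℝ => w - t * (z - w)) (𝓝[>] 0) (𝓝 w) := by
    have : Tendsto (fun t : ℝ => w - t * (z - w)) (𝓝 0) (𝓝 (w - 0 * (z - w))) :=
      Continuous.tendsto (by fun_prop) 0
    simpa using this.mono_left nhdsWithin_le_nhds
  have hev : ∀ᶠ t in 𝓝[>] (0 : ℝ), U w ≤ U z - q * (z - w) + A / 2 * t * (z - w) ^ 2 := by
    filter_upwards [hlim.eventually hj, hlim.eventually (Ioo_mem_nhds hw.1 hw.2),
      self_mem_nhdsWithin] with t ht1 ht2 ht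
    have ht : 0 < t := ht
    have h1 : 0 < 1 + t := by linarith
    have := hU.2 hz ht2 (show 0 ≤ t / (1 + t) by positivity)
      (show 0 ≤ 1 / (1 + t) by positivity) (by field_simp; ring)
    have e : (t / (1 + t)) • z + (1 / (1 + t)) • (w - t * (z - w)) = w := by
      simp only [smul_eq_mul]; field_simp; ring
    rw [e] at this
    simp only [smul_eq_mul] at this
    have h2 : (1 + t) * U w ≤ t * U z + U (w - t * (z - w)) := by
      have := mul_le_mul_of_nonneg_left this h1.le
      refine this.trans (le_of_eq ?_)
      field_simp
    have h3 : t * U w ≤ t * (U z - q * (z - w) + A / 2 * t * (z - w) ^ 2) := by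
      nlinarith
    exact le_of_mul_le_mul_left h3 ht
  have hlim2 : Tendsto (fun t : ℝ => U z - q * (z - w) + A / 2 * t * (z - w) ^ 2) (𝓝[>] 0)
      (𝓝 (U z - q * (z - w))) := by
    have : Tendsto (fun t : ℝ => U z - q * (z - w) + A / 2 * t * (z - w) ^ 2) (𝓝 0)
        (𝓝 (U z - q * (z - w) + A / 2 * 0 * (z - w) ^ 2)) :=
      Continuous.tendsto (by fun_prop) 0
    simpa using this.mono_left nhdsWithin_le_nhds
  have := ge_of_tendsto hlim2 hev
  linarith

theorem ConvexOn.lowerBound_of_leftDeriv {U : ℝ → ℝ} {a d x p : ℝ}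
    (hU : ConvexOn ℝ (Ioo a d) U) (hx : x ∈ Ioo a d) (hp : HasDerivWithinAt U p (Iio x) x)
    {y : ℝ} (hy : y ∈ Ioo a d) (hyx : y ≤ x) : U x + p * (y - x) ≤ U y := by
  rcases hyx.eq_or_lt with rfl | hlt
  · simp
  have := hU.slope_le_of_hasDerivWithinAt_Iio hy hx hlt hp
  rw [slope_def_field, div_le_iff₀ (by linarith)] at this
  linarith

theorem ConvexOn.lowerBound_of_rightDeriv {U : ℝ → ℝ} {a d x p : ℝ}
    (hU : ConvexOn ℝ (Ioo a d) U) (hx : x ∈ Ioo a d) (hp : HasDerivWithinAt U p (Ioi x) x)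
    {y : ℝ} (hy : y ∈ Ioo a d) (hyx : x ≤ y) : U x + p * (y - x) ≤ U y := by
  rcases hyx.eq_or_lt with rfl | hlt
  · simp
  have := hU.le_slope_of_hasDerivWithinAt_Ioi hx hy hlt hp
  rw [slope_def_field, le_div_iff₀ (by linarith)] at this
  linarith

/-- A secant to the left of `x` with slope above `p'` keeps such a slope when its right end moves
slightly, and it bounds the subgradients there from below. -/
theorem eventually_lt_subgradient {U : ℝ → ℝ} {a d x p p' : ℝ} (hx : x ∈ Ioo a d)
    (hc : ContinuousAt U x) (hp : HasDerivWithinAt U p (Iio x) x) (hp' : p' < p) :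
    ∀ᶠ w in 𝓝 x, ∀ q, IsSubgradientOn U a d w q → p' < q := by
  have h1 := (hasDerivWithinAt_iff_tendsto_slope' (by simp)).1 hp
  obtain ⟨y, hy1, hy2, hy3⟩ := ((h1.eventually (lt_mem_nhds hp')).and
    ((eventually_nhdsWithin_of_eventually_nhds (Ioo_mem_nhds hx.1 hx.2)).and
      self_mem_nhdsWithin)).exists
  have hyx : y < x := hy3
  rw [slope_comm, slope_def_field, lt_div_iff₀ (by linarith)] at hy1
  have h2 : ContinuousAt (fun w => U w - U y - p' * (w - y)) x := by fun_prop
  filter_upwards [h2.eventually (lt_mem_nhds (show (0 : ℝ) < U x - U y - p' * (x - y) by linarith)),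
    lt_mem_nhds hyx] with w hw1 hw2 q hq
  have := hq y hy2
  have hwy : 0 < w - y := by linarith
  nlinarith

theorem eventually_subgradient_lt {U : ℝ → ℝ} {a d x p p' : ℝ} (hx : x ∈ Ioo a d)
    (hc : ContinuousAt U x) (hp : HasDerivWithinAt U p (Ioi x) x) (hp' : p < p') :
    ∀ᶠ w in 𝓝 x, ∀ q, IsSubgradientOn U a d w q → q < p' := by
  have h1 := (hasDerivWithinAt_iff_tendsto_slope' (by simp)).1 hp
  obtain ⟨y, hy1, hy2, hy3⟩ := ((h1.eventually (gt_mem_nhds hp')).and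
    ((eventually_nhdsWithin_of_eventually_nhds (Ioo_mem_nhds hx.1 hx.2)).and
      self_mem_nhdsWithin)).exists
  have hyx : x < y := hy3
  rw [slope_def_field, div_lt_iff₀ (by linarith)] at hy1
  have h2 : ContinuousAt (fun w => p' * (y - w) - (U y - U w)) x := by fun_prop
  filter_upwards [h2.eventually (lt_mem_nhds (show (0 : ℝ) < p' * (y - x) - (U y - U x)
    by linarith)), gt_mem_nhds hyx] with w hw1 hw2 q hq
  have := hq y hy2
  have hwy : 0 < y - w := by linarith
  nlinarith

/-! ### The transformed equation and comparison at a maximum point. -/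

/-- Jet form of the subsolution property for
`H(U) = inf_π {s U'' π ^ 2 + k U' π + ℓ(x) U'}`. -/
def JetSubsolution (H ℓ : ℝ → ℝ) (s k a d : ℝ) (U : ℝ → ℝ) : Prop :=
  ∀ x ∈ Ioo a d, ∀ p A, UpperJet U x p A →
    ∀ π, H (U x) ≤ s * A * π ^ 2 + k * p * π + ℓ x * p

/-- Jet form of the supersolution property for
`H(V) = inf_π {s V'' π ^ 2 + k V' π + ℓ(x) V'}`. -/
def JetSupersolution (H ℓ : ℝ → ℝ) (s k a d : ℝ) (V : ℝ → ℝ) : Prop :=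
  ∀ x ∈ Ioo a d, ∀ p A, LowerJet V x p A →
    ∀ z, H (V x) < z → ∃ π, s * A * π ^ 2 + k * p * π + ℓ x * p < z

section Jet

variable {H ℓ : ℝ → ℝ} {s k a d : ℝ} {U V : ℝ → ℝ}

theorem JetSubsolution.convexOn (hs : 0 < s) (hU : UpperSemicontinuousOn U (Ioo a d))
    (hsub : JetSubsolution H ℓ s k a d U) : ConvexOn ℝ (Ioo a d) U := by
  have key : ∀ m : ℝ, m < 0 → ConvexOn ℝ (Ioo a d) (fun x => U x - m / 2 * x ^ 2) := by
    intro m hm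
    refine convexOn_of_no_upperJet hU fun w hw q hj => ?_
    have h := hsub w hw q m hj
    have hlim : Tendsto (fun π : ℝ => π * (s * m * π + k * q)) atTop atBot :=
      tendsto_id.atTop_mul_atBot₀ (tendsto_atBot_add_const_right _ _
        (tendsto_id.const_mul_atTop_of_neg (by nlinarith)))
    obtain ⟨π, hπ⟩ := (hlim.eventually (eventually_lt_atBot (H (U w) - ℓ w * q))).exists
    have := h π
    nlinarith
  refine ⟨convex_Ioo a d, fun x hx y hy α β hα hβ hαβ => ?_⟩
  have hlim : Tendsto (fun m : ℝ => α * (U x - m / 2 * x ^ 2) + β * (U y - m / 2 * y ^ 2)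
      + m / 2 * (α * x + β * y) ^ 2) (𝓝[<] 0) (𝓝 (α * U x + β * U y)) := by
    have : Tendsto (fun m : ℝ => α * (U x - m / 2 * x ^ 2) + β * (U y - m / 2 * y ^ 2)
      + m / 2 * (α * x + β * y) ^ 2) (𝓝 0) (𝓝 (α * (U x - 0 / 2 * x ^ 2) +
        β * (U y - 0 / 2 * y ^ 2) + 0 / 2 * (α * x + β * y) ^ 2)) :=
      Continuous.tendsto (by fun_prop) 0
    simpa using this.mono_left nhdsWithin_le_nhds
  refine ge_of_tendsto hlim ?_
  filter_upwards [self_mem_nhdsWithin] with m hm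
  have := (key m hm).2 hx hy hα hβ hαβ
  simp only [smul_eq_mul] at this ⊢
  linarith

/-- The equation bounds `H (U x)` by the drift term at the left derivative. -/
theorem JetSubsolution.le_drift_mul_leftDeriv (hU : UpperSemicontinuousOn U (Ioo a d))
    (hconv : ConvexOn ℝ (Ioo a d) U) (hsub : JetSubsolution H ℓ s k a d U)
    (hH : Continuous H) (hℓ : Continuous ℓ) (hℓ0 : ∀ x ∈ Ioo a d, ℓ x ≤ 0)
    {x p : ℝ} (hx : x ∈ Ioo a d) (hp : HasDerivWithinAt U p (Iio x) x) :
    H (U x) ≤ ℓ x * p := by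
  by_contra! hlt
  have hc : ContinuousAt U x :=
    (hconv.continuousOn isOpen_Ioo).continuousAt (Ioo_mem_nhds hx.1 hx.2)
  have h1 : ∀ᶠ p' in 𝓝[<] p, ℓ x * p' < H (U x) := by
    have : ContinuousAt (fun p' => ℓ x * p') p := by fun_prop
    exact mem_nhdsWithin_of_mem_nhds (this.eventually (gt_mem_nhds hlt))
  obtain ⟨p', hp'1, hp'2⟩ := (h1.and self_mem_nhdsWithin).exists
  have hcH : ContinuousAt (fun w => H (U w)) x := hH.continuousAt.comp hc
  have h2 : ContinuousAt (fun w => H (U w) - ℓ w * p') x :=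
    hcH.sub (hℓ.continuousAt.mul continuousAt_const)
  have h3 := (h2.eventually (lt_mem_nhds (sub_pos.2 hp'1))).and
    ((eventually_lt_subgradient hx hc hp hp'2).and (Ioo_mem_nhds hx.1 hx.2))
  obtain ⟨α, β, hαβ, hall⟩ := mem_nhds_iff_exists_Ioo_subset.1 h3
  have hsubI : Ioo α β ⊆ Ioo a d := fun w hw => (hall hw).2.2
  -- Slopes of upper jets near `x` exceed `p'`, so `ℓ ≤ 0` and the choice `π = 0` rule out every
  -- curvature.
  have hno : ∀ w ∈ Ioo α β, ∀ q A, ¬ UpperJet U w q A := by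
    intro w hw q A hj
    obtain ⟨i1, i2, i3⟩ := hall hw
    have i4 := i2 q (hconv.isSubgradientOn_of_upperJet i3 hj)
    have i5 := hsub w i3 q A hj 0
    have i6 := hℓ0 w i3
    nlinarith
  obtain ⟨h, hh0, hh⟩ : ∃ h > 0, x - h ∈ Ioo α β ∧ x + h ∈ Ioo α β := by
    refine ⟨min (x - α) (β - x) / 2, ?_, ?_⟩
    · have := lt_min (sub_pos.2 hαβ.1) (sub_pos.2 hαβ.2)
      positivity
    · have := lt_min (sub_pos.2 hαβ.1) (sub_pos.2 hαβ.2)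
      have a1 := min_le_left (x - α) (β - x)
      have a2 := min_le_right (x - α) (β - x)
      refine ⟨⟨?_, ?_⟩, ⟨?_, ?_⟩⟩ <;> linarith [hαβ.1, hαβ.2]
  -- Without upper jets, `U - m / 2 * x ^ 2` is convex for every `m`. This `m` exceeds the second
  -- difference quotient of `U`, contradicting midpoint convexity.
  set m : ℝ := (U (x + h) + U (x - h) - 2 * U x + 1) / h ^ 2 with hm
  have hm' : m * h ^ 2 = U (x + h) + U (x - h) - 2 * U x + 1 := by
    rw [hm]; field_simp
  have hcv := (convexOn_of_no_upperJet (m := m) (hU.mono hsubI) fun w hw q => hno w hw q m).2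
    hh.1 hh.2 (show (0 : ℝ) ≤ 1 / 2 by norm_num) (show (0 : ℝ) ≤ 1 / 2 by norm_num) (by norm_num)
  simp only [smul_eq_mul] at hcv
  have e : 1 / 2 * (x - h) + 1 / 2 * (x + h) = x := by ring
  rw [e] at hcv
  nlinarith

/-- The minimum over `π` of `s A π² + k p π` is `-k² p² / (4 s A)` for `A > 0`, which tends to `0`
as `A` grows. The curvature used in the proof makes it `-η` when `k p ≠ 0`. -/
theorem JetSupersolution.drift_mul_le (hs : 0 < s)
    (hsup : JetSupersolution H ℓ s k a d V) {x p : ℝ} (hx : x ∈ Ioo a d)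
    (hV : ∀ A, LowerJet V x p A) : ℓ x * p ≤ H (V x) := by
  by_contra! hlt
  set η := (ℓ x * p - H (V x)) / 2 with hη
  have hη0 : 0 < η := by rw [hη]; linarith
  obtain ⟨π, hπ⟩ := hsup x hx p (k ^ 2 * p ^ 2 / (4 * s * η)) (hV _) (H (V x) + η) (by linarith)
  have e : s * (k ^ 2 * p ^ 2 / (4 * s * η)) * π ^ 2 + k * p * π
      = (k * p * π / 2 + η) ^ 2 / η - η := by
    field_simp; ring
  rw [e] at hπ
  have : 0 ≤ (k * p * π / 2 + η) ^ 2 / η := by positivity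
  linarith

/-- By continuity the strict violation persists at nearby points and slopes, and subgradients near a
point of differentiability are close to `p`. So no upper jet nearby has curvature `m`, `U - m / 2 *
x ^ 2` is locally convex, and its tangent line at `x` is the required jet. -/
theorem JetSubsolution.lowerJet_of_lt (hU : UpperSemicontinuousOn U (Ioo a d))
    (hconv : ConvexOn ℝ (Ioo a d) U) (hsub : JetSubsolution H ℓ s k a d U)
    (hH : Continuous H) (hℓ : Continuous ℓ) {x p m π : ℝ} (hx : x ∈ Ioo a d)
    (hp : HasDerivAt U p x) (hlt : s * m * π ^ 2 + k * p * π + ℓ x * p < H (U x)) :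
    LowerJet U x p m := by
  have hc : ContinuousAt U x := hp.continuousAt
  have hcH : ContinuousAt (fun w => H (U w)) x := hH.continuousAt.comp hc
  have h1 : ContinuousAt (fun z : ℝ × ℝ => H (U z.1) -
      (s * m * π ^ 2 + k * z.2 * π + ℓ z.1 * z.2)) (x, p) := by
    have a1 : ContinuousAt (fun z : ℝ × ℝ => H (U z.1)) (x, p) :=
      ContinuousAt.comp (f := Prod.fst) (x := (x, p)) hcH continuousAt_fst
    have a2 : Continuous (fun z : ℝ × ℝ => s * m * π ^ 2 + k * z.2 * π + ℓ z.1 * z.2) := by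
      fun_prop
    exact a1.sub a2.continuousAt
  have h2 := h1.eventually (lt_mem_nhds (sub_pos.2 hlt))
  rw [nhds_prod_eq, eventually_prod_iff] at h2
  obtain ⟨P, hP, Q, hQ, hPQ⟩ := h2
  obtain ⟨p₁, p₂, hpI, hpall⟩ := mem_nhds_iff_exists_Ioo_subset.1 hQ
  have h3 := hP.and ((eventually_lt_subgradient hx hc hp.hasDerivWithinAt hpI.1).and
    ((eventually_subgradient_lt hx hc hp.hasDerivWithinAt hpI.2).and (Ioo_mem_nhds hx.1 hx.2)))
  obtain ⟨α, β, hαβ, hall⟩ := mem_nhds_iff_exists_Ioo_subset.1 h3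
  have hsubI : Ioo α β ⊆ Ioo a d := fun w hw => (hall hw).2.2.2
  have hno : ∀ w ∈ Ioo α β, ∀ q, ¬ UpperJet U w q m := by
    intro w hw q hj
    obtain ⟨i1, i2, i3, i4⟩ := hall hw
    have i5 := hconv.isSubgradientOn_of_upperJet i4 hj
    have i6 := hPQ i1 (hpall ⟨i2 q i5, i3 q i5⟩)
    have i7 := hsub w i4 q m hj π
    linarith
  have hcv := convexOn_of_no_upperJet (hU.mono hsubI) hno
  have hd : HasDerivAt (fun x => U x - m / 2 * x ^ 2) (p - m * x) x := by
    have : HasDerivAt (fun x : ℝ => m / 2 * x ^ 2) (m * x) x :=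
      ((hasDerivAt_pow 2 x).const_mul (m / 2)).congr_deriv (by norm_num; ring)
    exact hp.sub this
  filter_upwards [Ioo_mem_nhds hαβ.1 hαβ.2] with y hy
  have : U x - m / 2 * x ^ 2 + (p - m * x) * (y - x) ≤ U y - m / 2 * y ^ 2 := by
    rcases le_total y x with hyx | hyx
    · exact hcv.lowerBound_of_leftDeriv hαβ hd.hasDerivWithinAt hy hyx
    · exact hcv.lowerBound_of_rightDeriv hαβ hd.hasDerivWithinAt hy hyx
  nlinarith

theorem LowerJet.of_isMaxOn_sub {x p A : ℝ} (hj : LowerJet U x p A)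
    (hx : x ∈ Ioo a d) (hmax : IsMaxOn (fun w => U w - V w) (Ioo a d) x) : LowerJet V x p A := by
  filter_upwards [hj, Ioo_mem_nhds hx.1 hx.2] with y hy hyI
  have := hmax hyI
  simp only [mem_ofPred_eq] at this
  linarith

/-- At an interior maximum of `U - V`, a subsolution `U` and a supersolution `V` satisfy
`H (U x) ≤ H (V x)` as soon as `0 < H (U x)`. -/
theorem JetSubsolution.le_of_isMaxOn_sub (hs : 0 < s) (hk : k ≠ 0)
    (hU : UpperSemicontinuousOn U (Ioo a d))
    (hsub : JetSubsolution H ℓ s k a d U) (hsup : JetSupersolution H ℓ s k a d V)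
    (hH : Continuous H) (hℓ : Continuous ℓ) (hℓ0 : ∀ x ∈ Ioo a d, ℓ x ≤ 0)
    {x : ℝ} (hx : x ∈ Ioo a d) (hmax : IsMaxOn (fun w => U w - V w) (Ioo a d) x)
    (hpos : 0 < H (U x)) : H (U x) ≤ H (V x) := by
  by_contra! hlt
  have hconv := hsub.convexOn hs hU
  have hxi : x ∈ interior (Ioo a d) := by rwa [interior_Ioo]
  have hL := hconv.hasDerivWithinAt_leftDeriv_of_mem_interior hxi
  have hR := hconv.hasDerivWithinAt_rightDeriv_of_mem_interior hxi
  have hLR := hconv.leftDeriv_le_rightDeriv_of_mem_interior hxi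
  set pL := derivWithin U (Iio x) x
  set pR := derivWithin U (Ioi x) x
  have hA := hsub.le_drift_mul_leftDeriv hU hconv hH hℓ hℓ0 hx hL
  rcases hLR.eq_or_lt with heq | hlt'
  · have hd : HasDerivAt U pL x := by
      rw [← heq] at hR
      have := hL.union hR
      rw [Iio_union_Ioi, compl_eq_univ_sdiff, hasDerivWithinAt_sdiff_singleton,
        hasDerivWithinAt_univ] at this
      exact this
    obtain ⟨z, hz1, hz2⟩ := exists_between hlt
    obtain ⟨z', hz'1, hz'2⟩ := exists_between hz1
    have hp0 : pL ≠ 0 := by rintro h0; rw [h0] at hA; linarith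
    have hgap : 0 < ℓ x * pL - z := by linarith
    -- With curvature `k² pL² / (4 s D)` the minimum over `π` of the full expression is exactly `z`.
    -- Being below `H (U x)`, it makes the jet a lower jet; the supersolution property then demands
    -- a value below `z`.
    set D := ℓ x * pL - z with hD
    have hform : ∀ π, s * (k ^ 2 * pL ^ 2 / (4 * s * D)) * π ^ 2 + k * pL * π
        = (k * pL * π / 2 + D) ^ 2 / D - D := by
      intro π; field_simp; ring
    have hj : LowerJet U x pL (k ^ 2 * pL ^ 2 / (4 * s * D)) := by
      refine hsub.lowerJet_of_lt (π := -2 * D / (k * pL)) hU hconv hH hℓ hx hd ?_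
      rw [hform]
      have : k * pL * (-2 * D / (k * pL)) / 2 + D = 0 := by field_simp; ring
      rw [this]
      simp only [ne_eq, OfNat.ofNat_ne_zero, not_false_eq_true, zero_pow, zero_div]
      linarith
    obtain ⟨π, hπ⟩ := hsup x hx _ _ (hj.of_isMaxOn_sub hx hmax) z hz1
    rw [hform] at hπ
    have : 0 ≤ (k * pL * π / 2 + D) ^ 2 / D := by positivity
    linarith
  -- At a kink a parabola of any curvature and slope `p` stays locally below the two one-sided
  -- tangents.
  · have hB : ∀ p ∈ Ioo pL pR, ℓ x * p ≤ H (V x) := by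
      intro p hp
      refine hsup.drift_mul_le hs hx fun A => LowerJet.of_isMaxOn_sub ?_ hx hmax
      have h1 : ∀ᶠ y in 𝓝 x, A / 2 * (y - x) < pR - p := by
        have : ContinuousAt (fun y => A / 2 * (y - x)) x := by fun_prop
        exact this.eventually (gt_mem_nhds (by simpa using hp.2))
      have h2 : ∀ᶠ y in 𝓝 x, pL - p < A / 2 * (y - x) := by
        have : ContinuousAt (fun y => A / 2 * (y - x)) x := by fun_prop
        exact this.eventually (lt_mem_nhds (by simpa using hp.1))
      filter_upwards [h1, h2, Ioo_mem_nhds hx.1 hx.2] with y hy1 hy2 hyI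
      rcases le_total y x with hyx | hyx
      · have := hconv.lowerBound_of_leftDeriv hx hL hyI hyx
        nlinarith
      · have := hconv.lowerBound_of_rightDeriv hx hR hyI hyx
        nlinarith
    have hlim : Tendsto (fun p => ℓ x * p) (𝓝[>] pL) (𝓝 (ℓ x * pL)) :=
      (Continuous.tendsto (by fun_prop) pL).mono_left nhdsWithin_le_nhds
    have : ℓ x * pL ≤ H (V x) := by
      refine le_of_tendsto hlim ?_
      filter_upwards [Ioo_mem_nhdsGT hlt'] with p hp using hB p hp
    linarith

end Jet

/-! ### Localization of test functions. -/

/-- A local `C²` majorant of a function bounded above extends to a global `C²` majorant. -/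
theorem exists_contDiff_majorant {s : Set ℝ} {u ψ : ℝ → ℝ} {x M : ℝ}
    (hM : ∀ w ∈ s, u w ≤ M) (hψ : ContDiffAt ℝ 2 ψ x) (hle : ∀ᶠ y in 𝓝 x, u y ≤ ψ y) :
    ∃ φ : ℝ → ℝ, ContDiff ℝ 2 φ ∧ φ =ᶠ[𝓝 x] ψ ∧ ∀ w ∈ s, u w ≤ φ w := by
  obtain ⟨ρ, hρ, hball⟩ := Metric.eventually_nhds_iff_ball.1
    ((hψ.eventually (by decide)).and hle)
  let χ : ContDiffBump x := ⟨ρ / 4, ρ / 2, by positivity, by linarith⟩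
  -- On the ball this is a convex combination of two majorants of `u`; outside it equals `M`.
  refine ⟨fun y => χ y * ψ y + (1 - χ y) * M, ?_, ?_, ?_⟩
  · refine contDiff_iff_contDiffAt.2 fun y => ?_
    by_cases hy : y ∈ Metric.ball x ρ
    · have := (hball y hy).1
      exact (χ.contDiffAt.mul this).add ((contDiffAt_const.sub χ.contDiffAt).mul contDiffAt_const)
    · have hy' : y ∈ (tsupport χ)ᶜ := by
        rw [χ.tsupport_eq, mem_compl_iff, Metric.mem_closedBall, not_le]
        rw [Metric.mem_ball, not_lt] at hy
        exact lt_of_lt_of_le (show ρ / 2 < ρ by linarith) hy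
      have h0 : (fun y => χ y * ψ y + (1 - χ y) * M) =ᶠ[𝓝 y] fun _ => M := by
        filter_upwards [(isClosed_tsupport χ).isOpen_compl.mem_nhds hy'] with z hz
        rw [image_eq_zero_of_notMem_tsupport hz]; ring
      exact contDiffAt_const.congr_of_eventuallyEq h0
  · filter_upwards [χ.eventuallyEq_one] with y hy
    rw [hy]; simp
  · intro w hw
    have h1 := χ.nonneg (x := w)
    have h2 := χ.le_one (x := w)
    have h3 := hM w hw
    by_cases hwb : w ∈ Metric.ball x ρ
    · have := (hball w hwb).2
      have e : u w = χ w * u w + (1 - χ w) * u w := by ring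
      rw [e]
      exact add_le_add (mul_le_mul_of_nonneg_left this h1)
        (mul_le_mul_of_nonneg_left h3 (by linarith))
    · have : χ w = 0 := by
        refine χ.zero_of_le_dist ?_
        rw [Metric.mem_ball, not_lt] at hwb
        exact (show ρ / 2 ≤ ρ by linarith).trans hwb
      simp only [this]; linarith

theorem IsViscositySubsolution.apply_local {F : ℝ → ℝ → ℝ → ℝ → EReal} {a d : ℝ} {u ψ : ℝ → ℝ}
    (h : IsViscositySubsolution F a d u) {x M : ℝ} (hM : ∀ w ∈ Ioo a d, u w ≤ M)
    (hx : x ∈ Ioo a d) (hψ : ContDiffAt ℝ 2 ψ x) (hle : ∀ᶠ y in 𝓝 x, u y ≤ ψ y)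
    (heq : ψ x = u x) : F x (u x) (deriv ψ x) (deriv (deriv ψ) x) ≤ 0 := by
  obtain ⟨φ, hφ, hφψ, hge⟩ := exists_contDiff_majorant hM hψ hle
  rw [← hφψ.deriv_eq, ← hφψ.deriv.deriv_eq]
  refine h φ hφ.contDiffOn x hx fun w hw => ?_
  have h1 := hφψ.eq_of_nhds
  have h2 := hge w hw
  simp only [mem_ofPred_eq]
  linarith

theorem IsViscositySupersolution.apply_local {F : ℝ → ℝ → ℝ → ℝ → EReal} {a d : ℝ} {v ψ : ℝ → ℝ}
    (h : IsViscositySupersolution F a d v) {x M : ℝ} (hM : ∀ w ∈ Ioo a d, M ≤ v w)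
    (hx : x ∈ Ioo a d) (hψ : ContDiffAt ℝ 2 ψ x) (hle : ∀ᶠ y in 𝓝 x, ψ y ≤ v y)
    (heq : ψ x = v x) : 0 ≤ F x (v x) (deriv ψ x) (deriv (deriv ψ) x) := by
  obtain ⟨φ, hφ, hφψ, hge⟩ := exists_contDiff_majorant (u := fun w => -v w)
    (fun w hw => neg_le_neg (hM w hw)) hψ.neg (hle.mono fun y hy => neg_le_neg hy)
  have hφψ' : (fun w => -φ w) =ᶠ[𝓝 x] ψ := by
    filter_upwards [hφψ] with w hw
    rw [hw]; exact neg_neg _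
  rw [← hφψ'.deriv_eq, ← hφψ'.deriv.deriv_eq]
  refine h _ hφ.neg.contDiffOn x hx fun w hw => ?_
  have h1 := hφψ'.eq_of_nhds
  have h2 := hge w hw
  simp only [mem_ofPred_eq]
  linarith

theorem le_hjbIntegrand_of_hjbF_nonpos {r μ σ c lam ε w z p A : ℝ}
    (h : hjbF r μ σ c lam ε w z p A ≤ 0) (π : ℝ) :
    lam * z ≤ hjbIntegrand r μ σ c ε w p A π := by
  rw [hjbF, EReal.sub_nonpos] at h
  exact EReal.coe_le_coe_iff.1 (h.trans (iInf_le _ π))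

theorem exists_hjbIntegrand_lt_of_hjbF_nonneg {r μ σ c lam ε w z p A : ℝ}
    (h : 0 ≤ hjbF r μ σ c lam ε w z p A) {y : ℝ} (hy : lam * z < y) :
    ∃ π, hjbIntegrand r μ σ c ε w p A π < y := by
  rw [hjbF, EReal.sub_nonneg (Or.inl (EReal.coe_ne_top _)) (Or.inl (EReal.coe_ne_bot _))] at h
  obtain ⟨π, hπ⟩ := iInf_lt_iff.1 (h.trans_lt (EReal.coe_lt_coe_iff.2 hy))
  exact ⟨π, EReal.coe_lt_coe_iff.1 hπ⟩

/-! ### Quadratic jets and the exponential change of unknown. -/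

/-- The quadratic polynomial with value `z`, slope `p` and second derivative `A` at `x`. -/
noncomputable def quadAt (x z p A y : ℝ) : ℝ := z + p * (y - x) + A / 2 * (y - x) ^ 2

theorem hasDerivAt_quadAt (x z p A y : ℝ) : HasDerivAt (quadAt x z p A) (p + A * (y - x)) y := by
  have h1 : HasDerivAt (fun y : ℝ => y - x) 1 y := (hasDerivAt_id y).sub_const x
  have h2 := ((h1.const_mul p).const_add z).add ((h1.pow 2).const_mul (A / 2))
  exact h2.congr_deriv (by norm_num; ring)

theorem contDiff_quadAt (x z p A : ℝ) : ContDiff ℝ 2 (quadAt x z p A) := by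
  unfold quadAt; fun_prop

theorem quadAt_self (x z p A : ℝ) : quadAt x z p A x = z := by simp [quadAt]

theorem deriv_quadAt (x z p A : ℝ) : deriv (quadAt x z p A) = fun y => p + A * (y - x) :=
  funext fun y => (hasDerivAt_quadAt x z p A y).deriv

theorem deriv_deriv_quadAt (x z p A : ℝ) : deriv (deriv (quadAt x z p A)) x = A := by
  rw [deriv_quadAt]
  have h : HasDerivAt (fun y : ℝ => p + A * (y - x)) (A * 1) x :=
    (((hasDerivAt_id x).sub_const x).const_mul A).const_add p
  simp [h.deriv]

theorem contDiffAt_log_quadAt {x z p A : ℝ} (hz : 0 < z) (ε : ℝ) :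
    ContDiffAt ℝ 2 (fun y => Real.log (quadAt x z p A y) / ε) x :=
  ((contDiff_quadAt x z p A).contDiffAt.log (by rw [quadAt_self]; exact hz.ne')).div_const ε

theorem eventually_quadAt_pos {x z p A : ℝ} (hz : 0 < z) : ∀ᶠ y in 𝓝 x, 0 < quadAt x z p A y :=
  (contDiff_quadAt x z p A).continuous.continuousAt.eventually
    (lt_mem_nhds (by rw [quadAt_self]; exact hz))

theorem deriv_log_quadAt {x z p A : ℝ} (hz : 0 < z) (ε : ℝ) :
    deriv (fun y => Real.log (quadAt x z p A y) / ε) =ᶠ[𝓝 x]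
      fun y => (p + A * (y - x)) / quadAt x z p A y / ε := by
  filter_upwards [eventually_quadAt_pos hz] with y hy
  exact (((hasDerivAt_quadAt x z p A y).log hy.ne').div_const ε).deriv

theorem deriv_deriv_log_quadAt {x z p A : ℝ} (hz : 0 < z) (ε : ℝ) :
    deriv (deriv (fun y => Real.log (quadAt x z p A y) / ε)) x = (A * z - p * p) / z ^ 2 / ε := by
  rw [(deriv_log_quadAt hz ε).deriv_eq]
  have h : HasDerivAt (fun y : ℝ => p + A * (y - x)) (A * 1) x :=
    (((hasDerivAt_id x).sub_const x).const_mul A).const_add p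
  have h2 := (h.div (hasDerivAt_quadAt x z p A x) (by rw [quadAt_self]; exact hz.ne')).div_const ε
  refine h2.deriv.trans ?_
  simp [quadAt_self]

section Transform

variable {r μ σ c lam ε a d M : ℝ} {u v : ℝ → ℝ}

theorem IsViscositySubsolution.jetSubsolution
    (h : IsViscositySubsolution (hjbF r μ σ c lam 0) a d u) (hM : ∀ w ∈ Ioo a d, u w ≤ M) :
    JetSubsolution (fun z => lam * z) (fun x => r * x - c) (1 / 2 * σ ^ 2) (μ - r) a d u := by
  intro x hx p A hj π
  have := le_hjbIntegrand_of_hjbF_nonpos (h.apply_local hM hx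
    (contDiff_quadAt x (u x) p A).contDiffAt hj (quadAt_self _ _ _ _)) π
  rw [deriv_deriv_quadAt, deriv_quadAt] at this
  simpa [hjbIntegrand] using this

theorem IsViscositySupersolution.jetSupersolution
    (h : IsViscositySupersolution (hjbF r μ σ c lam 0) a d v) (hM : ∀ w ∈ Ioo a d, M ≤ v w) :
    JetSupersolution (fun z => lam * z) (fun x => r * x - c) (1 / 2 * σ ^ 2) (μ - r) a d v := by
  intro x hx p A hj z hz
  obtain ⟨π, hπ⟩ := exists_hjbIntegrand_lt_of_hjbF_nonneg (h.apply_local hM hx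
    (contDiff_quadAt x (v x) p A).contDiffAt hj (quadAt_self _ _ _ _)) hz
  rw [deriv_deriv_quadAt, deriv_quadAt] at hπ
  exact ⟨π, by simpa [hjbIntegrand] using hπ⟩

/-- For `φ = log q / ε`, the quantity `ε φ'² + φ''` equals `q'' / (ε q)`: the squared gradient
cancels. -/
theorem hjbIntegrand_log_quadAt (hε : 0 < ε) {x z p A : ℝ} (hz : 0 < z) (π : ℝ) :
    hjbIntegrand r μ σ c ε x (deriv (fun y => Real.log (quadAt x z p A y) / ε) x)
      (deriv (deriv (fun y => Real.log (quadAt x z p A y) / ε)) x) π =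
    (1 / 2 * σ ^ 2 * A * π ^ 2 + (μ - r) * p * π + (r * x - c) * p) / (ε * z) := by
  rw [deriv_deriv_log_quadAt hz, (deriv_log_quadAt hz ε).eq_of_nhds, quadAt_self, hjbIntegrand]
  field_simp
  ring

theorem IsViscositySubsolution.jetSubsolution_exp (hε : 0 < ε)
    (h : IsViscositySubsolution (hjbF r μ σ c lam ε) a d u) (hM : ∀ w ∈ Ioo a d, u w ≤ M) :
    JetSubsolution (fun z => lam * (z * Real.log z)) (fun x => r * x - c) (1 / 2 * σ ^ 2) (μ - r)
      a d (fun w => Real.exp (ε * u w)) := by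
  intro x hx p A hj π
  have hz : 0 < Real.exp (ε * u x) := Real.exp_pos _
  have hle : ∀ᶠ y in 𝓝 x, u y ≤ Real.log (quadAt x (Real.exp (ε * u x)) p A y) / ε := by
    filter_upwards [hj] with y hy
    rw [le_div_iff₀ hε, mul_comm (u y), ← Real.log_exp (ε * u y)]
    exact Real.log_le_log (Real.exp_pos _) hy
  have := le_hjbIntegrand_of_hjbF_nonpos (h.apply_local hM hx (contDiffAt_log_quadAt hz ε) hle
    (by rw [quadAt_self, Real.log_exp]; field_simp)) π
  rw [hjbIntegrand_log_quadAt hε hz, le_div_iff₀ (by positivity)] at this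
  simp only [Real.log_exp]
  linarith

theorem IsViscositySupersolution.jetSupersolution_exp (hε : 0 < ε)
    (h : IsViscositySupersolution (hjbF r μ σ c lam ε) a d v) (hM : ∀ w ∈ Ioo a d, M ≤ v w) :
    JetSupersolution (fun z => lam * (z * Real.log z)) (fun x => r * x - c) (1 / 2 * σ ^ 2)
      (μ - r) a d (fun w => Real.exp (ε * v w)) := by
  intro x hx p A hj z hz
  have hz0 : 0 < Real.exp (ε * v x) := Real.exp_pos _
  have hle : ∀ᶠ y in 𝓝 x, Real.log (quadAt x (Real.exp (ε * v x)) p A y) / ε ≤ v y := by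
    filter_upwards [hj, eventually_quadAt_pos hz0] with y hy hy0
    rw [div_le_iff₀ hε, mul_comm (v y), ← Real.log_exp (ε * v y)]
    exact Real.log_le_log hy0 hy
  simp only [Real.log_exp] at hz
  obtain ⟨π, hπ⟩ := exists_hjbIntegrand_lt_of_hjbF_nonneg (h.apply_local hM hx
    (contDiffAt_log_quadAt hz0 ε) hle (by rw [quadAt_self, Real.log_exp]; field_simp))
    (y := z / (ε * Real.exp (ε * v x))) (by rw [lt_div_iff₀ (by positivity)]; linarith)
  rw [hjbIntegrand_log_quadAt hε hz0, div_lt_div_iff_of_pos_right (by positivity)] at hπ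
  exact ⟨π, hπ⟩

end Transform

/-! ### Comparison principle. -/

/-- Comparison principle in jet form. -/
theorem JetSubsolution.le_supersolution {H ℓ : ℝ → ℝ} {s k a d : ℝ} {U V : ℝ → ℝ}
    (hs : 0 < s) (hk : k ≠ 0)
    (hU : UpperSemicontinuousOn U (Icc a d)) (hV : LowerSemicontinuousOn V (Icc a d))
    (hsub : JetSubsolution H ℓ s k a d U) (hsup : JetSupersolution H ℓ s k a d V)
    (hH : Continuous H) (hℓ : Continuous ℓ) (hℓ0 : ∀ x ∈ Ioo a d, ℓ x ≤ 0)
    (ha : U a ≤ V a) (hd : U d ≤ V d)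
    (hmono : ∀ x ∈ Ioo a d, V x < U x → 0 < H (U x) ∧ H (V x) < H (U x)) :
    ∀ w ∈ Icc a d, U w ≤ V w := by
  intro w hw
  by_contra! hlt
  have hVn : UpperSemicontinuousOn (fun w => -V w) (Icc a d) :=
    continuous_neg.comp_lowerSemicontinuousOn_antitone hV fun _ _ h => neg_le_neg h
  obtain ⟨x, hx, hmax⟩ := (hU.add hVn).exists_isMaxOn ⟨w, hw⟩ isCompact_Icc
  have hxw := hmax hw
  simp only [mem_ofPred_eq] at hxw
  have hxpos : V x < U x := by linarith
  have hxI : x ∈ Ioo a d := by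
    refine ⟨lt_of_le_of_ne hx.1 ?_, lt_of_le_of_ne hx.2 ?_⟩
    · rintro rfl; linarith
    · rintro rfl; linarith
  obtain ⟨h1, h2⟩ := hmono x hxI hxpos
  have hmax' : IsMaxOn (fun w => U w - V w) (Ioo a d) x := fun y hy => by
    have := hmax (Ioo_subset_Icc_self hy)
    simp only [mem_ofPred_eq] at this ⊢
    linarith
  exact h2.not_ge (hsub.le_of_isMaxOn_sub hs hk (hU.mono Ioo_subset_Icc_self) hsup hH hℓ hℓ0 hxI
    hmax' h1)

/-- Comparison principle for the HJB equation. -/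
theorem IsViscositySubsolution.le_supersolution {r μ σ c lam ε b : ℝ}
    (hr : 0 < r) (hμ : r < μ) (hσ : 0 < σ) (hlam : 0 < lam) (hε : 0 ≤ ε)
    {u v : ℝ → ℝ} (hu : UpperSemicontinuousOn u (Icc b (c / r)))
    (hv : LowerSemicontinuousOn v (Icc b (c / r)))
    (hub : BoundedOn (Icc b (c / r)) u) (hvb : BoundedOn (Icc b (c / r)) v)
    (hsub : IsViscositySubsolution (hjbF r μ σ c lam ε) b (c / r) u)
    (hsup : IsViscositySupersolution (hjbF r μ σ c lam ε) b (c / r) v)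
    (hpos : (∀ w ∈ Ioo b (c / r), 0 ≤ v w) ∨ (∀ w ∈ Ioo b (c / r), 0 < u w))
    (hb : u b ≤ v b) (hd : u (c / r) ≤ v (c / r)) :
    ∀ w ∈ Icc b (c / r), u w ≤ v w := by
  obtain ⟨M, hM⟩ := hub
  obtain ⟨N, hN⟩ := hvb
  have hM' : ∀ w ∈ Ioo b (c / r), u w ≤ M := fun w hw =>
    (abs_le.1 (hM w (Ioo_subset_Icc_self hw))).2
  have hN' : ∀ w ∈ Ioo b (c / r), -N ≤ v w := fun w hw =>
    (abs_le.1 (hN w (Ioo_subset_Icc_self hw))).1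
  have hs : 0 < 1 / 2 * σ ^ 2 := by positivity
  have hk : μ - r ≠ 0 := (sub_pos.2 hμ).ne'
  have hℓ : Continuous fun x => r * x - c := by fun_prop
  have hℓ0 : ∀ x ∈ Ioo b (c / r), r * x - c ≤ 0 := fun x hx => by
    have := (lt_div_iff₀ hr).1 hx.2
    linarith
  have hupos : ∀ x ∈ Ioo b (c / r), v x < u x → 0 < u x := fun x hx hlt =>
    hpos.elim (fun h => (h x hx).trans_lt hlt) fun h => h x hx
  rcases hε.eq_or_lt with rfl | hε
  · exact (hsub.jetSubsolution hM').le_supersolution hs hk hu hv (hsup.jetSupersolution hN')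
      (by fun_prop) hℓ hℓ0 hb hd fun x hx hlt =>
        ⟨mul_pos hlam (hupos x hx hlt), mul_lt_mul_of_pos_left hlt hlam⟩
  · have hmono : Monotone fun z => Real.exp (ε * z) := fun y z h =>
      Real.exp_le_exp.2 (mul_le_mul_of_nonneg_left h hε.le)
    have hcont : Continuous fun z => Real.exp (ε * z) := by fun_prop
    have key := (hsub.jetSubsolution_exp hε hM').le_supersolution hs hk
      (hcont.comp_upperSemicontinuousOn hu hmono) (hcont.comp_lowerSemicontinuousOn hv hmono)
      (hsup.jetSupersolution_exp hε hN') (Real.continuous_mul_log.const_mul lam) hℓ hℓ0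
      (hmono hb) (hmono hd) ?_
    · intro w hw
      exact le_of_mul_le_mul_left (Real.exp_le_exp.1 (key w hw)) hε
    -- The function `z * log z` is not monotone on `(0, 1)`; positivity of `u x` still orders the
    -- two values, even if `v x < 0`.
    · intro x hx hlt
      have hlt' : ε * v x < ε * u x := Real.exp_lt_exp.1 hlt
      have hu0 : 0 < ε * u x := mul_pos hε (hupos x hx (lt_of_mul_lt_mul_left hlt' hε.le))
      simp only [Function.comp_apply, Real.log_exp]
      refine ⟨by positivity, mul_lt_mul_of_pos_left ?_ hlam⟩
      calc Real.exp (ε * v x) * (ε * v x) < Real.exp (ε * v x) * (ε * u x) := by gcongr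
        _ ≤ Real.exp (ε * u x) * (ε * u x) := by gcongr

/-! ### Semicontinuous envelopes. -/

section Envelope

variable {s : Set ℝ} {u : ℝ → ℝ} {w : ℝ}

theorem BoundedOn.isBoundedUnder_le (h : BoundedOn s u) (w : ℝ) :
    IsBoundedUnder (· ≤ ·) (𝓝[s] w) u := by
  obtain ⟨M, hM⟩ := h
  exact ⟨M, eventually_map.2 (eventually_nhdsWithin_of_forall fun x hx => (abs_le.1 (hM x hx)).2)⟩

theorem BoundedOn.isBoundedUnder_ge (h : BoundedOn s u) (w : ℝ) :
    IsBoundedUnder (· ≥ ·) (𝓝[s] w) u := by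
  obtain ⟨M, hM⟩ := h
  exact ⟨-M, eventually_map.2 (eventually_nhdsWithin_of_forall fun x hx => (abs_le.1 (hM x hx)).1)⟩

theorem frequently_nhdsWithin_of_self {p : ℝ → Prop} (hw : w ∈ s) (hp : p w) :
    ∃ᶠ x in 𝓝[s] w, p x := fun h => h.self_of_nhdsWithin hw hp

theorem le_uscEnvelope (h : BoundedOn s u) (hw : w ∈ s) : u w ≤ uscEnvelope s u w :=
  le_limsup_of_frequently_le (frequently_nhdsWithin_of_self hw le_rfl) (h.isBoundedUnder_le w)

theorem lscEnvelope_le (h : BoundedOn s u) (hw : w ∈ s) : lscEnvelope s u w ≤ u w :=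
  liminf_le_of_frequently_le (frequently_nhdsWithin_of_self hw le_rfl) (h.isBoundedUnder_ge w)

theorem uscEnvelope_le_of_eventually (h : BoundedOn s u) (hw : w ∈ s) {M : ℝ}
    (hM : ∀ᶠ x in 𝓝[s] w, u x ≤ M) : uscEnvelope s u w ≤ M := by
  have : (𝓝[s] w).NeBot := mem_closure_iff_nhdsWithin_neBot.1 (subset_closure hw)
  exact limsup_le_of_le (h.isBoundedUnder_ge w).isCoboundedUnder_le hM

theorem le_lscEnvelope_of_eventually (h : BoundedOn s u) (hw : w ∈ s) {M : ℝ}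
    (hM : ∀ᶠ x in 𝓝[s] w, M ≤ u x) : M ≤ lscEnvelope s u w := by
  have : (𝓝[s] w).NeBot := mem_closure_iff_nhdsWithin_neBot.1 (subset_closure hw)
  exact le_liminf_of_le (h.isBoundedUnder_le w).isCoboundedUnder_ge hM

theorem boundedOn_uscEnvelope (h : BoundedOn s u) : BoundedOn s (uscEnvelope s u) := by
  obtain ⟨M, hM⟩ := id h
  refine ⟨M, fun w hw => abs_le.2 ⟨(abs_le.1 (hM w hw)).1.trans (le_uscEnvelope h hw), ?_⟩⟩
  exact uscEnvelope_le_of_eventually h hw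
    (eventually_nhdsWithin_of_forall fun x hx => (abs_le.1 (hM x hx)).2)

theorem boundedOn_lscEnvelope (h : BoundedOn s u) : BoundedOn s (lscEnvelope s u) := by
  obtain ⟨M, hM⟩ := id h
  refine ⟨M, fun w hw => abs_le.2 ⟨?_, (lscEnvelope_le h hw).trans (abs_le.1 (hM w hw)).2⟩⟩
  exact le_lscEnvelope_of_eventually h hw
    (eventually_nhdsWithin_of_forall fun x hx => (abs_le.1 (hM x hx)).1)

theorem upperSemicontinuousOn_uscEnvelope (h : BoundedOn s u) :
    UpperSemicontinuousOn (uscEnvelope s u) s := by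
  intro w hw y hy
  obtain ⟨y', h1, h2⟩ := exists_between hy
  have h3 : ∀ᶠ x in 𝓝[s] w, u x < y' := eventually_lt_of_limsup_lt h1 (h.isBoundedUnder_le w)
  filter_upwards [eventually_eventually_nhdsWithin.2 h3, self_mem_nhdsWithin] with x hx hxs
  exact (uscEnvelope_le_of_eventually h hxs (hx.mono fun _ => le_of_lt)).trans_lt h2

theorem lowerSemicontinuousOn_lscEnvelope (h : BoundedOn s u) :
    LowerSemicontinuousOn (lscEnvelope s u) s := by
  intro w hw y hy
  obtain ⟨y', h1, h2⟩ := exists_between hy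
  have h3 : ∀ᶠ x in 𝓝[s] w, y' < u x := eventually_lt_of_lt_liminf h2 (h.isBoundedUnder_ge w)
  filter_upwards [eventually_eventually_nhdsWithin.2 h3, self_mem_nhdsWithin] with x hx hxs
  exact h1.trans_le (le_lscEnvelope_of_eventually h hxs (hx.mono fun _ => le_of_lt))

theorem uscEnvelope_eq_of_continuousWithinAt (hw : w ∈ s) (hc : ContinuousWithinAt u s w) :
    uscEnvelope s u w = u w := by
  have : (𝓝[s] w).NeBot := mem_closure_iff_nhdsWithin_neBot.1 (subset_closure hw)
  exact hc.tendsto.limsup_eq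

theorem lscEnvelope_eq_of_continuousWithinAt (hw : w ∈ s) (hc : ContinuousWithinAt u s w) :
    lscEnvelope s u w = u w := by
  have : (𝓝[s] w).NeBot := mem_closure_iff_nhdsWithin_neBot.1 (subset_closure hw)
  exact hc.tendsto.liminf_eq

end Envelope

/-! ### The main theorem. -/

theorem proposition4p1 (r μ σ c lam ε b : ℝ)
    (hr : 0 < r) (hμ : r < μ) (hσ : 0 < σ) (hc : 0 < c) (hlam : 0 < lam) (hε : 0 ≤ ε)
    (hb : b < c / r) :
    (∀ u v : ℝ → ℝ,
      UpperSemicontinuousOn u (Icc b (c / r)) →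
      LowerSemicontinuousOn v (Icc b (c / r)) →
      BoundedOn (Icc b (c / r)) u →
      BoundedOn (Icc b (c / r)) v →
      IsViscositySubsolution (hjbF r μ σ c lam ε) b (c / r) u →
      IsViscositySupersolution (hjbF r μ σ c lam ε) b (c / r) v →
      ((∀ w ∈ Ioo b (c / r), 0 ≤ v w) ∨ (∀ w ∈ Ioo b (c / r), 0 < u w)) →
      u b ≤ v b → u (c / r) ≤ v (c / r) →
      ∀ w ∈ Icc b (c / r), u w ≤ v w) ∧
    (∀ u₁ u₂ : ℝ → ℝ,
      (∀ u ∈ ({u₁, u₂} : Set (ℝ → ℝ)),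
        IsBoundedViscositySolution (hjbF r μ σ c lam ε) b (c / r) u ∧
        (∀ w ∈ Icc b (c / r), 0 ≤ u w) ∧
        ContinuousWithinAt u (Icc b (c / r)) b ∧
        ContinuousWithinAt u (Icc b (c / r)) (c / r) ∧
        u b = 1 ∧ u (c / r) = 0) →
      EqOn u₁ u₂ (Icc b (c / r))) := by
  refine ⟨fun u v hu hv hub hvb hsub hsup hpos h1 h2 =>
    hsub.le_supersolution hr hμ hσ hlam hε hu hv hub hvb hsup hpos h1 h2, fun u₁ u₂ h => ?_⟩
  have hbm : b ∈ Icc b (c / r) := left_mem_Icc.2 hb.le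
  have hdm : c / r ∈ Icc b (c / r) := right_mem_Icc.2 hb.le
  have key : ∀ u ∈ ({u₁, u₂} : Set (ℝ → ℝ)), ∀ v ∈ ({u₁, u₂} : Set (ℝ → ℝ)),
      ∀ w ∈ Icc b (c / r), u w ≤ v w := by
    intro u hu v hv w hw
    obtain ⟨⟨hub, husub, -⟩, -, huc, huc', hu1, hu0⟩ := h u hu
    obtain ⟨⟨hvb, -, hvsup⟩, hvpos, hvc, hvc', hv1, hv0⟩ := h v hv
    -- The chain is `u ≤ u^* ≤ v_* ≤ v`. Continuity at the endpoints supplies the boundary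
    -- inequalities for the envelopes.
    refine (le_uscEnvelope hub hw).trans (le_trans ?_ (lscEnvelope_le hvb hw))
    refine husub.le_supersolution hr hμ hσ hlam hε (upperSemicontinuousOn_uscEnvelope hub)
      (lowerSemicontinuousOn_lscEnvelope hvb) (boundedOn_uscEnvelope hub)
      (boundedOn_lscEnvelope hvb) hvsup (Or.inl fun x hx => ?_) ?_ ?_ w hw
    · exact le_lscEnvelope_of_eventually hvb (Ioo_subset_Icc_self hx)
        (eventually_nhdsWithin_of_forall hvpos)
    · rw [uscEnvelope_eq_of_continuousWithinAt hbm huc,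
        lscEnvelope_eq_of_continuousWithinAt hbm hvc, hu1, hv1]
    · rw [uscEnvelope_eq_of_continuousWithinAt hdm huc',
        lscEnvelope_eq_of_continuousWithinAt hdm hvc', hu0, hv0]
  exact fun w hw => le_antisymm (key u₁ (by simp) u₂ (by simp) w hw)
    (key u₂ (by simp) u₁ (by simp) w hw)
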